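/- Let $K$ be a field and let $l,m,n$ be positive integers with $2\le m\le n$, $l\mid n$ and $l\le\min\{m-1,n/2\}$. Let $0\le s<l$ with $m\equiv s \pmod l$, put $t=(m-s)/l$ and $k=n/l$, and assume $t\ge 2$. Let $V=\{x_1,\dots,x_n\}$ be the vertex set of the cycle $C_n$, with indices read modulo $n$, and for $1\le i\le k$ let $F_i=\{x_{(i-1)l+1},x_{(i-1)l+2},\dots,x_{(i-1)l+m}\}$. Let $\Delta_{m,l}(C_n)=\langle F_1,\dots,F_k\rangle$ be the simplicial complex on $V$ generated by the $F_i$ (the path complex of $C_n$), and let $(\Delta_{m,l}(C_n))^c_V$ be the simplicial complex generated by the complements $V\setminus F$ of the facets $F$ of $\Delta_{m,l}(C_n)$, that is, $\langle V\setminus F_1,\dots,V\setminus F_k\rangle$ (the empty set is a face). Write $k=p(t+1)+d$ with integers $p\ge 0$ and $0\le d\le t$. Then for every integer $i$, the reduced simplicial homology with coefficients in $K$ is $$\widetilde H_i\big((\Delta_{m,l}(C_n))^c_V\big)\cong\begin{cases}K^t,&\text{if } d=0,\ i=2p-2 \text{ and } p>0;\\ K,&\text{if } d\ne 0 \text{ and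 } i=2p-1;\\ 0,&\text{otherwise.}\end{cases}$$ -/

import Mathlib

set_option maxSynthPendingDepth 3

/-! Simplicial complexes on a vertex type `V` are downward closed collections of finite subsets of
`V`, i.e. terms of `LowerSet (Finset V)`; the empty set is allowed as a face, so that the complex
`{∅}` differs from the void complex. The complex `⟨F₁, …, F_q⟩` generated by some finite sets is
their `lowerClosure`. -/

namespace SimplicialHomology

section Complexes

variable {V : Type*}

/-- The facets of a simplicial complex: its maximal faces under inclusion. -/
def facets (Δ : LowerSet (Finset V)) : Set (Finset V) :=
  {F | Maximal (· ∈ Δ) F}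

/-- The complement complex `Δ_V^c`, generated by the complements `V \ F` of the facets `F` of `Δ`. -/
def complementComplex [Fintype V] [DecidableEq V] (Δ : LowerSet (Finset V)) :
    LowerSet (Finset V) :=
  lowerClosure ((fun F : Finset V => Fᶜ) '' facets Δ)

end Complexes

section Homology

variable (K : Type*) [Field K] {V : Type*} [LinearOrder V]

/-- The sign `(-1)^a` with which the face `F \ {x}` occurs in the boundary of `F`, where `x` is
preceded by exactly `a` elements of `F`. -/
def faceSign (F : Finset V) (x : V) : K :=
  (-1) ^ (F.filter (· < x)).card

/-- The augmented simplicial boundary map, on the vector space with basis all finite subsets of `V`: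
`∂ {v₀ < ⋯ < v_i} = ∑ₐ (-1)^a {v₀, …, v_i} \ {v_a}`. In particular `∂ {v} = ∅` and `∂ ∅ = 0`. -/
noncomputable def boundary : (Finset V →₀ K) →ₗ[K] (Finset V →₀ K) :=
  Finsupp.linearCombination K fun F : Finset V =>
    ∑ x ∈ F, Finsupp.single (F.erase x) (faceSign K F x)

variable (Δ : LowerSet (Finset V)) (i : ℤ)

/-- The reduced `i`-chains of `Δ`: the span of the `i`-dimensional faces, i.e. those with `i + 1`
elements. For `i = -1` the only possible face is `∅`. -/
def chains : Submodule K (Finset V →₀ K) :=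
  Finsupp.supported K K {F | F ∈ Δ ∧ (F.card : ℤ) = i + 1}

/-- The reduced `i`-cycles `Z_i(Δ)`. -/
noncomputable def cycles : Submodule K (Finset V →₀ K) :=
  chains K Δ i ⊓ LinearMap.ker (boundary K)

/-- The reduced `i`-boundaries `B_i(Δ)`. -/
noncomputable def boundaries : Submodule K (Finset V →₀ K) :=
  (chains K Δ (i + 1)).map (boundary K)

/-- The reduced homology `H̃_i(Δ) = Z_i(Δ) / B_i(Δ)` with coefficients in `K`, for `i : ℤ`. -/
abbrev ReducedHomology : Type _ :=
  cycles K Δ i ⧸ (boundaries K Δ i).submoduleOf (cycles K Δ i)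

lemma boundary_single (F : Finset V) :
    boundary K (Finsupp.single F 1) =
      ∑ x ∈ F, Finsupp.single (F.erase x) (faceSign K F x) := by
  simp [boundary]

lemma faceSign_erase_of_lt {F : Finset V} {x y : V} (hx : x ∈ F) (h : x < y) :
    faceSign K (F.erase x) y = - faceSign K F y := by
  have hmem : x ∈ F.filter (· < y) := by simp [hx, h]
  have hcard := Finset.card_erase_add_one hmem
  unfold faceSign
  rw [Finset.filter_erase, ← hcard, pow_succ]
  simp

lemma faceSign_erase_of_gt {F : Finset V} {x y : V} (h : y < x) :
    faceSign K (F.erase x) y = faceSign K F y := by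
  unfold faceSign
  rw [Finset.filter_erase, Finset.erase_eq_of_notMem]
  simp [h.le]

lemma boundary_boundary (c : Finset V →₀ K) : boundary K (boundary K c) = 0 := by
  suffices h : (boundary K).comp (boundary K) = (0 : (Finset V →₀ K) →ₗ[K] (Finset V →₀ K)) from
    LinearMap.congr_fun h c
  refine Finsupp.lhom_ext' fun F => LinearMap.ext_ring ?_
  have hs : ∀ (G : Finset V) (a : K), boundary K (Finsupp.single G a) =
      ∑ y ∈ G, Finsupp.single (G.erase y) (a * faceSign K G y) := by
    intro G a
    simp [boundary, Finset.smul_sum]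
  simp only [LinearMap.comp_apply, Finsupp.lsingle_apply, LinearMap.zero_apply]
  rw [boundary_single, map_sum]
  simp only [hs]
  rw [Finset.sum_sigma']
  refine Finset.sum_involution (fun q _ => ⟨q.2, q.1⟩) ?_ ?_ ?_ ?_
  · rintro ⟨x, y⟩ hq
    simp only [Finset.mem_sigma, Finset.mem_erase] at hq
    obtain ⟨hx, hyx, hy⟩ := hq
    dsimp only
    rw [Finset.erase_right_comm (a := y) (b := x), ← Finsupp.single_add]
    rcases lt_or_gt_of_ne hyx with h | h
    · rw [faceSign_erase_of_gt K h, faceSign_erase_of_lt K hy h]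
      simp [mul_comm]
    · rw [faceSign_erase_of_gt K h, faceSign_erase_of_lt K hx h]
      simp [mul_comm]
  · rintro ⟨x, y⟩ hq _ heq
    simp only [Finset.mem_sigma, Finset.mem_erase] at hq
    simp only [Sigma.mk.injEq] at heq
    exact hq.2.1 heq.1
  · rintro ⟨x, y⟩ hq
    simp only [Finset.mem_sigma, Finset.mem_erase] at hq ⊢
    exact ⟨hq.2.2, hq.2.1.symm, hq.1⟩
  · rintro ⟨x, y⟩ _
    rfl

lemma boundary_mem_chains {c : Finset V →₀ K} (hc : c ∈ chains K Δ (i + 1)) :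
    boundary K c ∈ chains K Δ i := by
  rw [boundary, Finsupp.linearCombination_apply]
  refine Submodule.sum_mem _ fun F hF => Submodule.smul_mem _ _ (Submodule.sum_mem _ fun x hx => ?_)
  obtain ⟨hFΔ, hcard⟩ := (Finsupp.mem_supported K c).1 hc hF
  refine Finsupp.single_mem_supported K _ ⟨Δ.lower (Finset.erase_subset x F) hFΔ, ?_⟩
  have := Finset.card_erase_add_one hx
  push_cast [← this] at hcard
  linarith

/-- Boundaries are cycles. -/
lemma boundaries_le_cycles : boundaries K Δ i ≤ cycles K Δ i := by
  rintro _ ⟨c, hc, rfl⟩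
  exact ⟨boundary_mem_chains K Δ i hc, boundary_boundary K c⟩

end Homology

end SimplicialHomology

namespace CyclePaths

/-- The path `{x_{il+1}, …, x_{il+m}}` of the cycle `C_n`, with indices read modulo `n`. The vertices
`x_1, …, x_n` of `C_n` are the elements `0, …, n - 1` of `Fin n`. -/
def path (n m l i : ℕ) : Finset (Fin n) :=
  Finset.univ.filter fun v => ∃ j < m, (v : ℕ) = (i * l + j) % n

/-- The path complex `Δ_{m,l}(C_n) = ⟨F_1, …, F_k⟩` with its standard labelling, where
`k = n / gcd (l, n)` and `F_{i+1} = path n m l i`. -/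
def pathComplex (n m l : ℕ) : LowerSet (Finset (Fin n)) :=
  lowerClosure {F | ∃ i < n / Nat.gcd l n, F = path n m l i}

end CyclePaths

/-! A set is a face of the complement complex iff it misses some path. The last vertex of each block
of length `l` dominates its block, so all other vertices can be removed. What remains is a cycle of
`k` columns, and the faces are the sets missing some cyclic segment of `t` columns; the remainder
`s` plays no role (`isConcentrated_of_blockEnds`, `mem_path_iff_of_mem_blockEnds`).

On the first `k - t` columns this is a simplex, since one segment lies wholly in the last `t`
columns. The others are restored one by one. The link of column `k - t + x` is a complex on a path
of `u = k - t + x` columns: the sets missing a segment of length `t` or the initial segment of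
length `c = x + 1` (`isConcentrated_cyclic`). Such a complex is, up to homology, the suspension of
the one for `(u - c, t + 1 - c)`, so two steps replace `u` by `u - (t + 1)` and raise the degree by
2. It ends in `{∅}` or in the void complex (`isConcentrated_segments`).

The link contributes a class iff `t + 1` divides `u - c = k - t - 1` or `u`. If `d = 0`, the first
holds for every `x`, giving `t` classes; otherwise only the second occurs, for the single value `x =
t - d`. All contributions have the same degree, so dimensions add
(`IsConcentrated.of_deletion_link`). -/

namespace SimplicialHomology

/-! ### Contraction and cone operators on chains, and their commutation with the boundary -/

section Operators

variable (K : Type*) [Field K] {V : Type*} [LinearOrder V]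

/-- Contraction by the vertex `v`: it sends a face `F` containing `v` to `± F \ {v}`, with the sign
of this term in the boundary of `F`, and a face not containing `v` to `0`. -/
noncomputable def contract (v : V) : (Finset V →₀ K) →ₗ[K] (Finset V →₀ K) :=
  Finsupp.linearCombination K fun F : Finset V =>
    if v ∈ F then Finsupp.single (F.erase v) (faceSign K F v) else 0

/-- The cone operator with apex `v`: it sends a face `F` not containing `v` to `± F ∪ {v}`, and a
face containing `v` to `0`. -/
noncomputable def cone (v : V) : (Finset V →₀ K) →ₗ[K] (Finset V →₀ K) :=
  Finsupp.linearCombination K fun F : Finset V =>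
    if v ∈ F then 0 else Finsupp.single (insert v F) (faceSign K F v)

lemma contract_single (v : V) (F : Finset V) (a : K) :
    contract K v (Finsupp.single F a) =
      if v ∈ F then Finsupp.single (F.erase v) (a * faceSign K F v) else 0 := by
  simp [contract]

lemma cone_single (v : V) (F : Finset V) (a : K) :
    cone K v (Finsupp.single F a) =
      if v ∈ F then 0 else Finsupp.single (insert v F) (a * faceSign K F v) := by
  simp [cone]

lemma faceSign_mul_self (F : Finset V) (x : V) : faceSign K F x * faceSign K F x = 1 := by
  simp [faceSign, ← mul_pow]

lemma faceSign_erase_self (F : Finset V) (x : V) :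
    faceSign K (F.erase x) x = faceSign K F x := by
  unfold faceSign
  rw [Finset.filter_erase, Finset.erase_eq_of_notMem]
  simp

lemma faceSign_insert_self (F : Finset V) (x : V) :
    faceSign K (insert x F) x = faceSign K F x := by
  unfold faceSign
  rw [Finset.filter_insert, if_neg (lt_irrefl x)]

lemma faceSign_insert_of_lt {F : Finset V} {x y : V} (hx : x ∉ F) (h : x < y) :
    faceSign K (insert x F) y = - faceSign K F y := by
  have := faceSign_erase_of_lt K (Finset.mem_insert_self x F) h
  rw [Finset.erase_insert hx] at this
  rw [this, neg_neg]

lemma faceSign_insert_of_gt {F : Finset V} {x y : V} (h : y < x) :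
    faceSign K (insert x F) y = faceSign K F y := by
  unfold faceSign
  rw [Finset.filter_insert, if_neg h.not_gt]

lemma contract_contract_add {x y : V} (hxy : x ≠ y) (c : Finset V →₀ K) :
    contract K x (contract K y c) + contract K y (contract K x c) = 0 := by
  induction c using Finsupp.induction_linear with
  | zero => simp
  | add f g hf hg =>
    simp only [map_add]
    rw [add_add_add_comm, hf, hg, add_zero]
  | single F a =>
    by_cases hx : x ∈ F <;> by_cases hy : y ∈ F <;>
      simp only [contract_single, hx, hy, if_true, if_false, map_zero, Finset.mem_erase, ne_eq,
        hxy, hxy.symm, not_false_eq_true, and_true, and_false, add_zero]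
    rw [Finset.erase_right_comm, ← Finsupp.single_add]
    rcases lt_or_gt_of_ne hxy with h | h
    · rw [faceSign_erase_of_gt K h, faceSign_erase_of_lt K hx h]
      simp [mul_right_comm]
    · rw [faceSign_erase_of_gt K h, faceSign_erase_of_lt K hy h]
      simp [mul_right_comm]

lemma contract_cone_add_of_ne {x v : V} (hxv : x ≠ v) (c : Finset V →₀ K) :
    contract K x (cone K v c) + cone K v (contract K x c) = 0 := by
  induction c using Finsupp.induction_linear with
  | zero => simp
  | add f g hf hg =>
    simp only [map_add]
    rw [add_add_add_comm, hf, hg, add_zero]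
  | single F a =>
    by_cases hx : x ∈ F <;> by_cases hv : v ∈ F <;>
      simp only [contract_single, cone_single, hx, hv, if_true, if_false, map_zero,
        Finset.mem_erase, Finset.mem_insert, ne_eq, hxv, hxv.symm, not_false_eq_true, and_true,
        and_false, add_zero, or_true, or_false]
    rw [Finset.erase_insert_of_ne hxv.symm, ← Finsupp.single_add]
    rcases lt_or_gt_of_ne hxv with h | h
    · rw [faceSign_insert_of_gt K h, faceSign_erase_of_lt K hx h]
      simp [mul_right_comm]
    · rw [faceSign_insert_of_lt K hv h, faceSign_erase_of_gt K h]
      simp [mul_right_comm]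

/-- As in the exterior algebra, where `contract` and `cone` are interior and exterior multiplication
by `v`: one summand fixes the faces through `v` and the other the faces away from `v`. -/
lemma contract_cone_add (v : V) (c : Finset V →₀ K) :
    contract K v (cone K v c) + cone K v (contract K v c) = c := by
  induction c using Finsupp.induction_linear with
  | zero => simp
  | add f g hf hg =>
    simp only [map_add]
    rw [add_add_add_comm, hf, hg]
  | single F a =>
    by_cases hv : v ∈ F <;>
      simp [contract_single, cone_single, hv, faceSign_erase_self, faceSign_insert_self, mul_assoc,
        faceSign_mul_self, -Finsupp.single_mul]

lemma contract_contract (v : V) (c : Finset V →₀ K) : contract K v (contract K v c) = 0 := by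
  induction c using Finsupp.induction_linear with
  | zero => simp
  | add f g hf hg => simp only [map_add, hf, hg, add_zero]
  | single F a =>
    by_cases hv : v ∈ F <;> simp [contract_single, hv, -Finsupp.single_mul]

lemma boundary_eq_sum_contract [Fintype V] (c : Finset V →₀ K) :
    boundary K c = ∑ x, contract K x c := by
  induction c using Finsupp.induction_linear with
  | zero => simp
  | add f g hf hg => simp only [map_add, hf, hg, Finset.sum_add_distrib]
  | single F a =>
    simp [boundary, contract_single, Finset.smul_sum, Finset.sum_ite_mem]

lemma boundary_contract [Finite V] (v : V) (c : Finset V →₀ K) :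
    boundary K (contract K v c) = - contract K v (boundary K c) := by
  have := Fintype.ofFinite V
  rw [eq_neg_iff_add_eq_zero]
  simp only [boundary_eq_sum_contract, map_sum, ← Finset.sum_add_distrib]
  refine Finset.sum_eq_zero fun x _ => ?_
  by_cases h : x = v
  · subst h
    simp [contract_contract]
  · exact contract_contract_add K h c

/-- Writing the boundary as the sum of all contractions, every contraction at `x ≠ v` anticommutes
with `cone K v`; only `x = v` leaves the identity. -/
lemma boundary_cone [Finite V] (v : V) (c : Finset V →₀ K) :
    boundary K (cone K v c) = c - cone K v (boundary K c) := by
  have := Fintype.ofFinite V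
  rw [eq_sub_iff_add_eq]
  simp only [boundary_eq_sum_contract, map_sum, ← Finset.sum_add_distrib]
  rw [Finset.sum_eq_single v, contract_cone_add]
  · intro x _ h
    exact contract_cone_add_of_ne K h c
  · simp

end Operators

/-! ### Deletion, link and chains of subcomplexes -/

section Faces

variable {V : Type*}

/-- The deletion of the vertex `v`: all faces not containing `v`. -/
def deletion (Δ : LowerSet (Finset V)) (v : V) : LowerSet (Finset V) where
  carrier := {F | v ∉ F ∧ F ∈ Δ}
  lower' _ _ hGF hF := ⟨fun h => hF.1 (hGF h), Δ.lower hGF hF.2⟩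

/-- The link of the vertex `v`: all faces not containing `v` whose union with `{v}` is a face. -/
def link [DecidableEq V] (Δ : LowerSet (Finset V)) (v : V) : LowerSet (Finset V) where
  carrier := {F | v ∉ F ∧ insert v F ∈ Δ}
  lower' _ _ hGF hF := ⟨fun h => hF.1 (hGF h), Δ.lower (Finset.insert_subset_insert v hGF) hF.2⟩

variable (K : Type*) [Field K]

lemma link_le_deletion [DecidableEq V] (Δ : LowerSet (Finset V)) (v : V) : link Δ v ≤ deletion Δ v :=
  fun F hF => ⟨hF.1, Δ.lower (Finset.subset_insert v F) hF.2⟩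

lemma deletion_le (Δ : LowerSet (Finset V)) (v : V) : deletion Δ v ≤ Δ := fun _ hF => hF.2

lemma chains_mono {Δ Γ : LowerSet (Finset V)} (h : Δ ≤ Γ) (i : ℤ) :
    chains K Δ i ≤ chains K Γ i :=
  Finsupp.supported_mono fun _ hF => ⟨h hF.1, hF.2⟩

/-- A linear map sends chains to chains as soon as it does so on faces. -/
lemma map_mem_chains {Δ Γ : LowerSet (Finset V)} {i j : ℤ}
    (f : (Finset V →₀ K) →ₗ[K] (Finset V →₀ K))
    (hf : ∀ F ∈ Δ, (F.card : ℤ) = i + 1 → f (Finsupp.single F 1) ∈ chains K Γ j)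
    {c : Finset V →₀ K} (hc : c ∈ chains K Δ i) : f c ∈ chains K Γ j := by
  rw [← Finsupp.sum_single c, Finsupp.sum, map_sum]
  refine Submodule.sum_mem _ fun F hF => ?_
  obtain ⟨h1, h2⟩ := (Finsupp.mem_supported K c).1 hc hF
  have := Submodule.smul_mem _ (c F) (hf F h1 h2)
  rwa [← map_smul, Finsupp.smul_single, smul_eq_mul, mul_one] at this

-- Rank-nullity on a subspace, used to split cycles and boundaries along `contract K v`.
variable {K} in
lemma finrank_eq_map_add_inf_ker [Finite V]
    (f : (Finset V →₀ K) →ₗ[K] (Finset V →₀ K)) (S : Submodule K (Finset V →₀ K)) :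
    Module.finrank K S =
      Module.finrank K (S.map f) + Module.finrank K ↥(S ⊓ LinearMap.ker f) := by
  have h := LinearMap.finrank_range_add_finrank_ker (f.domRestrict S)
  rw [LinearMap.range_domRestrict, LinearMap.ker_domRestrict] at h
  rw [← h, ← Submodule.map_comap_subtype, Submodule.finrank_map_subtype_eq]

end Faces

/-! ### Complexes with homology in a single degree -/

section Concentration

variable {V : Type*} [LinearOrder V] (K : Type*) [Field K]

lemma contract_mem_chains_link {Δ : LowerSet (Finset V)} (v : V) {i : ℤ} {c : Finset V →₀ K}
    (hc : c ∈ chains K Δ (i + 1)) : contract K v c ∈ chains K (link Δ v) i := by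
  refine map_mem_chains K _ (fun F hF hcard => ?_) hc
  rw [contract_single]
  split_ifs with hv
  · refine Finsupp.single_mem_supported K _ ⟨⟨by simp, by rwa [Finset.insert_erase hv]⟩, ?_⟩
    have := Finset.card_erase_add_one hv
    omega
  · exact Submodule.zero_mem _

lemma cone_mem_chains {Δ Γ : LowerSet (Finset V)} (v : V)
    (h : ∀ F ∈ Γ, v ∉ F → insert v F ∈ Δ) {i : ℤ} {c : Finset V →₀ K}
    (hc : c ∈ chains K Γ i) : cone K v c ∈ chains K Δ (i + 1) := by
  refine map_mem_chains K _ (fun F hF hcard => ?_) hc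
  rw [cone_single]
  split_ifs with hv
  · exact Submodule.zero_mem _
  · refine Finsupp.single_mem_supported K _ ⟨h F hF hv, ?_⟩
    rw [Finset.card_insert_of_notMem hv]
    push_cast
    omega

lemma contract_eq_zero {Δ : LowerSet (Finset V)} {v : V} (h : ∀ F ∈ Δ, v ∉ F) {i : ℤ}
    {c : Finset V →₀ K} (hc : c ∈ chains K Δ i) : contract K v c = 0 := by
  rw [contract, Finsupp.linearCombination_apply]
  refine Finset.sum_eq_zero fun F hF => ?_
  simp [h F ((Finsupp.mem_supported K c).1 hc hF).1]

/-- `contract K v ∘ cone K v` projects onto the faces away from `v`, and it fixes every chain killed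
by `contract K v`. -/
lemma mem_chains_deletion {Δ : LowerSet (Finset V)} {v : V} {i : ℤ} {c : Finset V →₀ K}
    (hc : c ∈ chains K Δ i) (h : contract K v c = 0) : c ∈ chains K (deletion Δ v) i := by
  have h2 := contract_cone_add K v c
  rw [h, map_zero, add_zero] at h2
  rw [← h2]
  refine map_mem_chains K (contract K v ∘ₗ cone K v) (fun F hF hcard => ?_) hc
  rw [LinearMap.comp_apply, cone_single]
  split_ifs with hv
  · rw [map_zero]
    exact Submodule.zero_mem _
  · rw [contract_single, if_pos (Finset.mem_insert_self v F), Finset.erase_insert hv]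
    exact Finsupp.single_mem_supported K _ ⟨⟨hv, hF⟩, hcard⟩

/-- The reduced homology of `Δ` vanishes outside degree `e`, where it has dimension `r`. -/
def IsConcentrated (Δ : LowerSet (Finset V)) (e : ℤ) (r : ℕ) : Prop :=
  (∀ i ≠ e, cycles K Δ i ≤ boundaries K Δ i) ∧
    Module.finrank K (cycles K Δ e) = Module.finrank K (boundaries K Δ e) + r

variable {K}

/-- With `r = 0` the degree is arbitrary, so acyclic pieces fit wherever `of_deletion_link` needs
them. -/
lemma isConcentrated_zero {Δ : LowerSet (Finset V)}
    (h : ∀ i, cycles K Δ i ≤ boundaries K Δ i) (e : ℤ) : IsConcentrated K Δ e 0 :=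
  ⟨fun i _ => h i, by rw [(h e).antisymm (boundaries_le_cycles K Δ e), add_zero]⟩

/-- A cone has no reduced homology. -/
lemma isConcentrated_of_cone [Finite V] {Δ : LowerSet (Finset V)} (v : V)
    (h : ∀ F ∈ Δ, insert v F ∈ Δ) (e : ℤ) : IsConcentrated K Δ e 0 := by
  refine isConcentrated_zero (fun i z hz => ?_) e
  refine ⟨cone K v z, cone_mem_chains K v (fun F hF _ => h F hF) hz.1, ?_⟩
  rw [boundary_cone, LinearMap.mem_ker.1 hz.2, map_zero, sub_zero]

lemma isConcentrated_bot (e : ℤ) : IsConcentrated K (⊥ : LowerSet (Finset V)) e 0 := by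
  refine isConcentrated_zero (fun i z hz => ?_) e
  have : z = 0 := by
    by_contra hne
    obtain ⟨F, hF⟩ := Finsupp.support_nonempty_iff.2 hne
    exact ((Finsupp.mem_supported K z).1 hz.1 hF).1
  rw [this]
  exact Submodule.zero_mem _

/-- If deletion and link of a vertex have reduced homology only in degrees `e` and `e - 1`, then
the long exact sequence of the vertex splits off a single short exact sequence. -/
theorem IsConcentrated.of_deletion_link [Finite V] {Δ : LowerSet (Finset V)} (v : V) {e : ℤ}
    {r₁ r₂ : ℕ} (hd : IsConcentrated K (deletion Δ v) e r₁)
    (hl : IsConcentrated K (link Δ v) (e - 1) r₂) : IsConcentrated K Δ e (r₁ + r₂) := by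
  have hvd : ∀ F ∈ deletion Δ v, v ∉ F := fun F hF => hF.1
  have hvl : ∀ F ∈ link Δ v, v ∉ F := fun F hF => hF.1
  have hcone : ∀ F ∈ link Δ v, v ∉ F → insert v F ∈ Δ := fun F hF _ => hF.2
  have hld : ∀ {i : ℤ}, chains K (link Δ v) i ≤ chains K (deletion Δ v) i :=
    fun {i} => chains_mono K (link_le_deletion Δ v) i
  have hdΔ : ∀ {i : ℤ}, chains K (deletion Δ v) i ≤ chains K Δ i :=
    fun {i} => chains_mono K (deletion_le Δ v) i
  -- the part of a chain away from `v`
  have hpart : ∀ {i : ℤ} {c}, c ∈ chains K Δ (i + 1) →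
      c - cone K v (contract K v c) ∈ chains K (deletion Δ v) (i + 1) := by
    intro i c hc
    have h1 := contract_mem_chains_link K v hc
    refine mem_chains_deletion K (Submodule.sub_mem _ hc (cone_mem_chains K v hcone h1)) ?_
    have h2 := contract_cone_add K v (contract K v c)
    rw [contract_contract, map_zero, add_zero] at h2
    rw [map_sub, h2, sub_self]
  refine ⟨fun i hi z hz => ?_, ?_⟩
  · obtain ⟨hzc, hz0⟩ := hz
    rw [SetLike.mem_coe, LinearMap.mem_ker] at hz0
    have hzc' : z ∈ chains K Δ ((i - 1) + 1) := by rwa [sub_add_cancel]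
    obtain ⟨b, hb, hbz⟩ := hl.1 (i - 1) (by omega)
      ⟨contract_mem_chains_link K v hzc', by
        rw [SetLike.mem_coe, LinearMap.mem_ker, boundary_contract, hz0, map_zero, neg_zero]⟩
    rw [sub_add_cancel] at hb
    have hbd : boundary K (cone K v b) = b - cone K v (contract K v z) := by
      rw [boundary_cone, hbz]
    -- The boundary of `cone K v b` cancels the part of `z` through `v`, leaving a homologous cycle
    -- of the deletion.
    have hmem : z + boundary K (cone K v b) ∈ chains K (deletion Δ v) i := by
      have := hpart hzc'
      rw [sub_add_cancel] at this
      rw [hbd, add_sub_left_comm, add_comm]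
      exact Submodule.add_mem _ this (hld hb)
    obtain ⟨a, ha, haz⟩ := hd.1 i hi ⟨hmem, by
      rw [SetLike.mem_coe, LinearMap.mem_ker, map_add, hz0, boundary_boundary, add_zero]⟩
    refine ⟨a - cone K v b, Submodule.sub_mem _ (hdΔ ha) (cone_mem_chains K v hcone hb), ?_⟩
    rw [map_sub, haz, add_sub_cancel_right]
  -- A link cycle `b` bounds some `a` in the deletion, which has no homology in degree `e - 1`; then
  -- `cone K v b - a` is a cycle lifting `b`.
  · have hZmap : (cycles K Δ e).map (contract K v) = cycles K (link Δ v) (e - 1) := by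
      apply le_antisymm
      · rintro _ ⟨z, ⟨hzc, hz0⟩, rfl⟩
        rw [SetLike.mem_coe, LinearMap.mem_ker] at hz0
        refine ⟨contract_mem_chains_link K v (by rwa [sub_add_cancel]), ?_⟩
        rw [SetLike.mem_coe, LinearMap.mem_ker, boundary_contract, hz0, map_zero, neg_zero]
      · rintro b ⟨hb, hb0⟩
        rw [SetLike.mem_coe, LinearMap.mem_ker] at hb0
        obtain ⟨a, ha, hab⟩ := hd.1 (e - 1) (by omega) ⟨hld hb, hb0⟩
        rw [sub_add_cancel] at ha
        have hcb := cone_mem_chains K v hcone hb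
        rw [sub_add_cancel] at hcb
        refine ⟨cone K v b - a, ⟨Submodule.sub_mem _ hcb (hdΔ ha), ?_⟩, ?_⟩
        · rw [SetLike.mem_coe, LinearMap.mem_ker, map_sub, boundary_cone, hb0, hab, map_zero,
            sub_zero, sub_self]
        · have h2 := contract_cone_add K v b
          rw [contract_eq_zero K hvl hb, map_zero, add_zero] at h2
          rw [map_sub, h2, contract_eq_zero K hvd ha, sub_zero]
    have hZker : cycles K Δ e ⊓ LinearMap.ker (contract K v) = cycles K (deletion Δ v) e := by
      apply le_antisymm
      · rintro z ⟨⟨hzc, hz0⟩, hz⟩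
        exact ⟨mem_chains_deletion K hzc hz, hz0⟩
      · rintro z ⟨hzc, hz0⟩
        exact ⟨⟨hdΔ hzc, hz0⟩, contract_eq_zero K hvd hzc⟩
    have hBmap : (boundaries K Δ e).map (contract K v) = boundaries K (link Δ v) (e - 1) := by
      apply le_antisymm
      · rintro _ ⟨_, ⟨c, hc, rfl⟩, rfl⟩
        refine ⟨- contract K v c, Submodule.neg_mem _ ?_, ?_⟩
        · rw [sub_add_cancel]
          exact contract_mem_chains_link K v hc
        · rw [map_neg, boundary_contract, neg_neg]
      · rintro _ ⟨b, hb, rfl⟩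
        rw [SetLike.mem_coe, sub_add_cancel] at hb
        refine ⟨_, ⟨- cone K v b, Submodule.neg_mem _ (cone_mem_chains K v hcone hb), rfl⟩, ?_⟩
        have h2 := contract_cone_add K v b
        rw [contract_eq_zero K hvl hb, map_zero, add_zero] at h2
        rw [map_neg, map_neg, ← boundary_contract, h2]
    -- If `contract K v` kills `∂c`, then `contract K v c` is a link cycle of degree `e`, hence `∂b`
    -- for some `b`. Replacing the part of `c` through `v` by `b` keeps the boundary and stays in
    -- the deletion.
    have hBker : boundaries K Δ e ⊓ LinearMap.ker (contract K v) =
        boundaries K (deletion Δ v) e := by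
      apply le_antisymm
      · rintro _ ⟨⟨c, hc, rfl⟩, hz⟩
        rw [SetLike.mem_coe, LinearMap.mem_ker] at hz
        have hb0 : boundary K (contract K v c) = 0 := by rw [boundary_contract, hz, neg_zero]
        obtain ⟨b, hb, hbc⟩ := hl.1 e (by omega) ⟨contract_mem_chains_link K v hc, hb0⟩
        refine ⟨_, Submodule.add_mem _ (hpart hc) (hld hb), ?_⟩
        rw [map_add, map_sub, boundary_cone, hb0, map_zero, sub_zero, hbc, sub_add_cancel]
      · rintro _ ⟨c, hc, rfl⟩
        refine ⟨⟨c, hdΔ hc, rfl⟩, ?_⟩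
        exact contract_eq_zero K hvd (boundary_mem_chains K _ _ hc)
    rw [finrank_eq_map_add_inf_ker (contract K v) (cycles K Δ e),
      finrank_eq_map_add_inf_ker (contract K v) (boundaries K Δ e), hZmap, hZker, hBmap, hBker,
      hd.2, hl.2]
    ring

/-- The complex `{∅}` has reduced homology only in degree `-1`. -/
lemma isConcentrated_singleton_empty {Δ : LowerSet (Finset V)} (h : ∀ F, F ∈ Δ ↔ F = ∅) :
    IsConcentrated K Δ (-1) 1 := by
  have hch : ∀ i, i ≠ -1 → chains K Δ i = ⊥ := by
    intro i hi
    rw [chains, ← Finsupp.supported_empty]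
    congr 1
    refine Set.eq_empty_of_forall_notMem fun F hF => hi ?_
    have hc := hF.2
    rw [(h F).1 hF.1, Finset.card_empty] at hc
    push_cast at hc
    omega
  have hcy : cycles K Δ (-1) = K ∙ Finsupp.single ∅ 1 := by
    have : chains K Δ (-1) = K ∙ Finsupp.single ∅ 1 := by
      rw [chains, ← Set.image_singleton (f := fun F : Finset V => Finsupp.single F (1 : K)),
        ← Finsupp.supported_eq_span_single]
      congr 1
      ext F
      simp only [Set.mem_ofPred_eq, Set.mem_singleton_iff, h]
      refine ⟨fun hF => hF.1, fun hF => ⟨hF, by simp [hF]⟩⟩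
    rw [cycles, this, inf_eq_left, Submodule.span_singleton_le_iff_mem, LinearMap.mem_ker,
      boundary_single, Finset.sum_empty]
  refine ⟨fun i hi => ?_, ?_⟩
  · rw [cycles, hch i hi, bot_inf_eq]
    exact bot_le
  · rw [hcy, boundaries, hch (-1 + 1) (by omega), Submodule.map_bot, finrank_bot, zero_add]
    exact finrank_span_singleton (by simp)

variable {Δ : LowerSet (Finset V)} {e : ℤ} {r : ℕ}

lemma IsConcentrated.subsingleton_of_ne (h : IsConcentrated K Δ e r) {i : ℤ} (hi : i ≠ e) :
    Subsingleton (ReducedHomology K Δ i) :=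
  Submodule.Quotient.subsingleton_iff.2
    (Submodule.submoduleOf_eq_top.2 (h.1 i hi))

lemma IsConcentrated.nonempty_linearEquiv [Finite V] (h : IsConcentrated K Δ e r) :
    Nonempty (ReducedHomology K Δ e ≃ₗ[K] (Fin r → K)) := by
  apply FiniteDimensional.nonempty_linearEquiv_of_finrank_eq
  have h1 := Submodule.finrank_quotient_add_finrank
    ((boundaries K Δ e).submoduleOf (cycles K Δ e))
  rw [(Submodule.submoduleOfEquivOfLe (boundaries_le_cycles K Δ e)).finrank_eq, h.2] at h1
  rw [Module.finrank_fin_fun]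
  change Module.finrank K (ReducedHomology K Δ e) + _ = _ at h1
  omega

end Concentration

end SimplicialHomology

namespace SimplicialHomology

/-! ### Complexes of sets avoiding a member of a family -/

section Avoiding

variable {V : Type*}

/-- The complex of all subsets of `A` that are disjoint from some member of the family `𝓔`. -/
def avoiding (A : Finset V) (𝓔 : Set (Finset V)) : LowerSet (Finset V) where
  carrier := {S | S ⊆ A ∧ ∃ E ∈ 𝓔, Disjoint S E}
  lower' _ _ hTS hS :=
    ⟨hTS.trans hS.1, hS.2.imp fun _ hE => ⟨hE.1, Finset.disjoint_of_subset_left hTS hE.2⟩⟩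

/-- Only the traces on `A` matter, and among them only the minimal ones; families are compared this
way below. -/
lemma avoiding_le_of_forall_exists {A : Finset V} {𝓔 𝓕 : Set (Finset V)}
    (h : ∀ E ∈ 𝓔, ∃ F ∈ 𝓕, ∀ v ∈ A, v ∈ F → v ∈ E) : avoiding A 𝓔 ≤ avoiding A 𝓕 := by
  rintro S ⟨hS, E, hE, hd⟩
  obtain ⟨F, hF, hFE⟩ := h E hE
  exact ⟨hS, F, hF, Finset.disjoint_left.2 fun v hv hvF =>
    Finset.disjoint_left.1 hd hv (hFE v (hS hv) hvF)⟩

variable {K : Type*} [Field K] [LinearOrder V]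

lemma deletion_avoiding (A : Finset V) (𝓔 : Set (Finset V)) (v : V) :
    deletion (avoiding A 𝓔) v = avoiding (A.erase v) 𝓔 := by
  ext S
  change (v ∉ S ∧ S ⊆ A ∧ _) ↔ (S ⊆ A.erase v ∧ _)
  rw [Finset.subset_erase]
  tauto

lemma link_avoiding {A : Finset V} (𝓔 : Set (Finset V)) {v : V} (hv : v ∈ A) :
    link (avoiding A 𝓔) v = avoiding (A.erase v) {E ∈ 𝓔 | v ∉ E} := by
  ext S
  change (v ∉ S ∧ insert v S ⊆ A ∧ ∃ E ∈ 𝓔, Disjoint (insert v S) E) ↔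
    (S ⊆ A.erase v ∧ ∃ E, (E ∈ 𝓔 ∧ v ∉ E) ∧ Disjoint S E)
  simp only [Finset.subset_erase, Finset.insert_subset_iff, Finset.disjoint_insert_left, hv,
    true_and, and_assoc]
  tauto

variable [Finite V] {A B : Finset V} {𝓔 : Set (Finset V)} {e : ℤ} {r : ℕ}

/-- Deletion and link both stay within this class of complexes: the link merely discards the members
through `v`. -/
lemma isConcentrated_avoiding_add {v : V} (hv : v ∈ A) {r₁ r₂ : ℕ}
    (h₁ : IsConcentrated K (avoiding (A.erase v) 𝓔) e r₁)
    (h₂ : IsConcentrated K (avoiding (A.erase v) {E ∈ 𝓔 | v ∉ E}) (e - 1) r₂) :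
    IsConcentrated K (avoiding A 𝓔) e (r₁ + r₂) := by
  rw [← deletion_avoiding] at h₁
  rw [← link_avoiding 𝓔 hv] at h₂
  exact h₁.of_deletion_link v h₂

lemma isConcentrated_avoiding_of_notMem {w : V} (hw : w ∈ A) (h : ∀ E ∈ 𝓔, w ∉ E) (e : ℤ) :
    IsConcentrated K (avoiding A 𝓔) e 0 := by
  refine isConcentrated_of_cone w ?_ e
  rintro S ⟨hS, E, hE, hd⟩
  exact ⟨Finset.insert_subset hw hS, E, hE, Finset.disjoint_insert_left.2 ⟨h E hE, hd⟩⟩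

/-- If some member of the family does not meet the nonempty set `A`, the complex is a simplex. -/
lemma isConcentrated_avoiding_of_disjoint {E : Finset V} (hE : E ∈ 𝓔) (hAE : Disjoint A E)
    (hA : A.Nonempty) (e : ℤ) : IsConcentrated K (avoiding A 𝓔) e 0 := by
  obtain ⟨w, hw⟩ := hA
  refine isConcentrated_of_cone w ?_ e
  rintro S ⟨hS, -⟩
  have h := Finset.insert_subset hw hS
  exact ⟨h, E, hE, Finset.disjoint_of_subset_left h hAE⟩

/-- Dominated vertices may be removed: the homology does not change if every removed vertex `v`
comes with a remaining vertex `w` such that all members of the family through `w` pass through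
`v`. -/
lemma isConcentrated_avoiding_of_dominated (hBA : B ⊆ A)
    (hdom : ∀ v ∈ A, v ∉ B → ∃ w ∈ B, ∀ E ∈ 𝓔, w ∈ E → v ∈ E)
    (h : IsConcentrated K (avoiding B 𝓔) e r) : IsConcentrated K (avoiding A 𝓔) e r := by
  induction A using Finset.strongInduction with
  | H A ih =>
    by_cases hAB : A ⊆ B
    · rwa [← hBA.antisymm hAB]
    · obtain ⟨v, hvA, hvB⟩ := Finset.not_subset.1 hAB
      obtain ⟨w, hwB, hw⟩ := hdom v hvA hvB
      have hwv : w ≠ v := fun h => hvB (h ▸ hwB)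
      refine isConcentrated_avoiding_add (r₂ := 0) hvA ?_ ?_
      · exact ih _ (Finset.erase_ssubset hvA) (Finset.subset_erase.2 ⟨hBA, hvB⟩)
          fun u hu => hdom u (Finset.mem_of_mem_erase hu)
      -- Members missing `v` also miss `w`, so the link of `v` is acyclic.
      · exact isConcentrated_avoiding_of_notMem (Finset.mem_erase.2 ⟨hwv, hBA hwB⟩)
          (fun E hE hwE => hE.2 (hw E hE.1 hwE)) _

end Avoiding

end SimplicialHomology

namespace CyclePaths

open SimplicialHomology

/-! ### Avoiding segments of a path, then of a cycle -/

section Columns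

variable {V : Type*} [Fintype V] (col : V → ℕ)

/-- The vertices whose column lies in `[a, b)`. -/
def columns (a b : ℕ) : Finset V :=
  Finset.univ.filter fun v => a ≤ col v ∧ col v < b

lemma mem_columns {a b : ℕ} {v : V} : v ∈ columns col a b ↔ a ≤ col v ∧ col v < b := by
  simp [columns]

/-- The initial segment of length `c` and all segments of length `t` of the columns `[a, a + u)`. -/
def segments (t a u c : ℕ) : Set (Finset V) :=
  {E | (c ≤ u ∧ E = columns col a (a + c)) ∨
    ∃ i, a ≤ i ∧ i + t ≤ a + u ∧ E = columns col i (i + t)}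

/-- The parameters for which the complex of `segments t a u c` has reduced homology of dimension
`r ≤ 1`, concentrated in degree `e`. -/
def SegmentDegree (t u c : ℕ) (e : ℤ) (r : ℕ) : Prop :=
  (∃ p : ℕ, u = p * (t + 1) + c ∧ e = 2 * p - 1 ∧ r = 1) ∨
  (∃ p : ℕ, u = p * (t + 1) + (t + 1) ∧ e = 2 * p ∧ r = 1) ∨
  ((∀ p : ℕ, u ≠ p * (t + 1) + c ∧ u ≠ p * (t + 1) + (t + 1)) ∧ r = 0)

/-- The numerical side of one desuspension: it swaps the two nonzero cases, lowering `p` when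
starting from the first. -/
lemma SegmentDegree.sub {t u c : ℕ} {e : ℤ} {r : ℕ} (hct : c ≤ t) (hcu : c < u)
    (h : SegmentDegree t u c e r) : SegmentDegree t (u - c) (t + 1 - c) (e - 1) r := by
  rcases h with ⟨p, hu, he, hr⟩ | ⟨p, hu, he, hr⟩ | ⟨h, hr⟩
  · obtain ⟨p, rfl⟩ := Nat.exists_eq_succ_of_ne_zero (n := p) (by rintro rfl; omega)
    refine Or.inr (Or.inl ⟨p, ?_, ?_, hr⟩)
    · rw [Nat.succ_mul] at hu
      omega
    · push_cast at he
      omega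
  · exact Or.inl ⟨p, by omega, by omega, hr⟩
  · refine Or.inr (Or.inr ⟨fun p => ⟨fun hp => ?_, fun hp => ?_⟩, hr⟩)
    · exact (h p).2 (by omega)
    · exact (h (p + 1)).1 (by rw [Nat.succ_mul]; omega)

variable {K : Type*} [Field K] [LinearOrder V] {col} {A : Finset V} {k : ℕ}

/-- The complex of the sets avoiding an initial segment of length `c` or some segment of length `t`
of a path of `u` vertices is a sphere or acyclic. -/
theorem isConcentrated_segments (hsurj : ∀ j < k, ∃ v ∈ A, col v = j)
    {t u c a : ℕ} (hc : 0 < c) (hct : c ≤ t) (hau : a + u ≤ k) {e : ℤ} {r : ℕ}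
    (h : SegmentDegree t u c e r) :
    IsConcentrated K (avoiding (A ∩ columns col a (a + u)) (segments col t a u c)) e r := by
  induction u using Nat.strong_induction_on generalizing a c e r with
  | _ u ih =>
  rcases lt_trichotomy u c with huc | huc | huc
  · have hr : r = 0 := by
      rcases h with ⟨p, hu, -, -⟩ | ⟨p, hu, -, -⟩ | ⟨-, hr⟩
      · omega
      · omega
      · exact hr
    -- No segment fits, since `u < c ≤ t`: the complex is void, without even the empty face.
    have hbot : avoiding (A ∩ columns col a (a + u)) (segments col t a u c) = ⊥ := by
      refine le_bot_iff.1 ?_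
      rintro S ⟨-, E, ⟨hE, -⟩ | ⟨i, hi, hiu, -⟩, -⟩ <;> omega
    rw [hr, hbot]
    exact isConcentrated_bot e
  · subst huc
    have her : e = -1 ∧ r = 1 := by
      rcases h with ⟨p, hu, he, hr⟩ | ⟨p, hu, -, -⟩ | ⟨h, -⟩
      · have hp : p = 0 := by
          rcases Nat.eq_zero_or_pos p with hp | hp
          · exact hp
          · have : 0 < p * (t + 1) := Nat.mul_pos hp t.succ_pos
            omega
        subst hp
        exact ⟨by simpa using he, hr⟩
      · omega
      · exact absurd (by simp) (h 0).1
    rw [her.1, her.2]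
    refine isConcentrated_singleton_empty fun S => ⟨?_, ?_⟩
    · rintro ⟨hS, E, hE, hd⟩
      refine Finset.eq_empty_of_forall_notMem fun v hv => Finset.disjoint_left.1 hd hv ?_
      have hv' := (Finset.mem_inter.1 (hS hv)).2
      rcases hE with ⟨-, rfl⟩ | ⟨i, hi, hiu, rfl⟩
      · exact hv'
      · rw [mem_columns] at hv' ⊢
        omega
    · rintro rfl
      exact ⟨Finset.empty_subset _, _, Or.inl ⟨le_rfl, rfl⟩, Finset.disjoint_empty_left _⟩
  · obtain ⟨v, hvA, hva⟩ := hsurj a (by omega)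
    obtain ⟨w, hwA, hwa⟩ := hsurj (a + c) (by omega)
    have hmem : ∀ x, x ∈ A ∩ columns col (a + c) (a + c + (u - c)) ↔
        x ∈ A ∧ a + c ≤ col x ∧ col x < a + u := by
      intro x
      rw [Finset.mem_inter, mem_columns, show a + c + (u - c) = a + u by omega]
    have hv : v ∉ A ∩ columns col (a + c) (a + c + (u - c)) := by
      rw [hmem]
      omega
    -- Every member through column `a` starts there and has length `c` or `t ≥ c`, so `v` dominates
    -- the first `c` columns.
    refine isConcentrated_avoiding_of_dominated
      (B := insert v (A ∩ columns col (a + c) (a + c + (u - c)))) ?_ ?_ ?_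
    · intro x hx
      rw [Finset.mem_inter, mem_columns]
      rcases Finset.mem_insert.1 hx with rfl | hx
      · exact ⟨hvA, by omega⟩
      · rw [hmem] at hx
        exact ⟨hx.1, by omega⟩
    · intro x hx hxB
      refine ⟨v, Finset.mem_insert_self _ _, ?_⟩
      rw [Finset.mem_inter, mem_columns] at hx
      rw [Finset.mem_insert, hmem] at hxB
      rintro E (⟨-, rfl⟩ | ⟨i, hi, hiu, rfl⟩) <;> rw [mem_columns, mem_columns]
      · have := hx.1
        have h2 : ¬ (a + c ≤ col x ∧ col x < a + u) := fun hh => hxB (Or.inr ⟨this, hh⟩)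
        omega
      · have := hx.1
        have h2 : ¬ (a + c ≤ col x ∧ col x < a + u) := fun hh => hxB (Or.inr ⟨this, hh⟩)
        omega
    -- Without `v`, the initial segment misses all that is left, so the deletion is a simplex and
    -- all homology comes from the link.
    · rw [← zero_add r]
      refine isConcentrated_avoiding_add (Finset.mem_insert_self _ _) ?_ ?_ <;>
        rw [Finset.erase_insert hv]
      · refine isConcentrated_avoiding_of_disjoint (E := columns col a (a + c))
          (Or.inl ⟨huc.le, rfl⟩) ?_ ⟨w, (hmem w).2 ⟨hwA, by omega⟩⟩ e
        refine Finset.disjoint_left.2 fun x hx => ?_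
        rw [hmem] at hx
        rw [mem_columns]
        omega
      · have key := ih (u - c) (by omega) (c := t + 1 - c) (a := a + c) (by omega) (by omega)
          (by omega) (h.sub hct huc)
        convert key using 1
        apply le_antisymm <;> refine avoiding_le_of_forall_exists ?_
        · rintro E ⟨⟨-, rfl⟩ | ⟨i, hi, hiu, rfl⟩, hvE⟩
          · rw [mem_columns] at hvE
            omega
          · rw [mem_columns] at hvE
            by_cases hic : a + c ≤ i
            · exact ⟨_, Or.inr ⟨i, hic, by omega, rfl⟩, fun x _ hx => hx⟩
            · refine ⟨_, Or.inl ⟨by omega, rfl⟩, fun x _ hx => ?_⟩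
              rw [mem_columns] at hx ⊢
              omega
        · rintro E (⟨hcu, rfl⟩ | ⟨i, hi, hiu, rfl⟩)
          -- Among segments missing column `a`, the one starting at `a + 1` has the shortest trace
          -- beyond column `a + c`: `t + 1 - c` columns, the new initial segment.
          · refine ⟨columns col (a + 1) (a + 1 + t),
              ⟨Or.inr ⟨a + 1, by omega, by omega, rfl⟩, ?_⟩, fun x hxA hx => ?_⟩
            · rw [mem_columns]
              omega
            · rw [hmem] at hxA
              rw [mem_columns] at hx ⊢
              omega
          · refine ⟨_, ⟨Or.inr ⟨i, by omega, by omega, rfl⟩, ?_⟩, fun x _ hx => hx⟩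
            rw [mem_columns]
            omega

/-- The complex of the sets avoiding some cyclic segment `P i`, formed by the columns
`i, …, i + t - 1` modulo `k`, restricted to the columns `0, …, k - t + x - 1`. Restoring the last
`t` columns one by one, the links of the restored vertices are complexes of `segments`. -/
lemma isConcentrated_cyclic (hinj : Set.InjOn col A)
    (hsurj : ∀ j < k, ∃ v ∈ A, col v = j) {t : ℕ} (ht : 0 < t) (htk : t < k)
    {P : ℕ → Finset V}
    (hP : ∀ i < k, ∀ v ∈ A,
      v ∈ P i ↔ (i ≤ col v ∧ col v < i + t) ∨ col v + k < i + t)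
    {e : ℤ} {R : ℕ → ℕ}
    (hR : ∀ x < t, ∃ r, R (x + 1) = R x + r ∧ SegmentDegree t (k - t + x) (x + 1) (e - 1) r)
    (hR0 : R 0 = 0) {x : ℕ} (hx : x ≤ t) :
    IsConcentrated K (avoiding (A ∩ columns col 0 (k - t + x)) {E | ∃ i < k, E = P i})
      e (R x) := by
  induction x with
  | zero =>
    obtain ⟨w, hwA, hw⟩ := hsurj 0 (by omega)
    rw [hR0]
    refine isConcentrated_avoiding_of_disjoint (E := P (k - t)) ?_ ?_ ⟨w, ?_⟩ e
    · exact ⟨k - t, by omega, rfl⟩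
    · refine Finset.disjoint_left.2 fun y hy => ?_
      rw [Finset.mem_inter, mem_columns] at hy
      rw [hP _ (by omega) y hy.1]
      omega
    · rw [Finset.mem_inter, mem_columns]
      exact ⟨hwA, by omega⟩
  | succ x ih =>
    obtain ⟨r, hr, hdeg⟩ := hR x (by omega)
    obtain ⟨v, hvA, hv⟩ := hsurj (k - t + x) (by omega)
    have herase : (A ∩ columns col 0 (k - t + (x + 1))).erase v =
        A ∩ columns col 0 (k - t + x) := by
      ext y
      simp only [Finset.mem_erase, Finset.mem_inter, mem_columns]
      constructor
      · rintro ⟨hyv, hyA, hy⟩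
        have : col y ≠ col v := fun h => hyv (hinj hyA hvA h)
        exact ⟨hyA, by omega⟩
      · rintro ⟨hyA, hy⟩
        refine ⟨?_, hyA, by omega⟩
        rintro rfl
        omega
    rw [hr]
    refine isConcentrated_avoiding_add (v := v) ?_ ?_ ?_
    · rw [Finset.mem_inter, mem_columns]
      exact ⟨hvA, by omega⟩
    · rw [herase]
      exact ih (by omega)
    · rw [herase]
      have key := isConcentrated_segments (K := K) hsurj (a := 0) (u := k - t + x)
        (c := x + 1) (by omega) (by omega) (by omega) hdeg
      rw [zero_add] at key
      convert key using 1
      apply le_antisymm <;> refine avoiding_le_of_forall_exists ?_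
      · rintro E ⟨⟨i, hik, rfl⟩, hvE⟩
        rw [hP i hik v hvA] at hvE
        by_cases hi : i + t ≤ k - t + x
        · refine ⟨_, Or.inr ⟨i, by omega, by omega, rfl⟩, fun y hy hyc => ?_⟩
          rw [Finset.mem_inter] at hy
          rw [mem_columns] at hyc
          rw [hP i hik y hy.1]
          omega
        · refine ⟨_, Or.inl ⟨by omega, rfl⟩, fun y hy hyc => ?_⟩
          rw [Finset.mem_inter] at hy
          rw [mem_columns] at hyc
          rw [hP i hik y hy.1]
          omega
      · rintro E (⟨hcu, rfl⟩ | ⟨i, hi, hiu, rfl⟩)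
        -- The initial segment is the trace of the cyclic segment starting just after the column of
        -- `v`; if that column is the last one, this start wraps around to `0`.
        · by_cases hxt : x + 1 = t
          · refine ⟨P 0, ⟨⟨0, by omega, rfl⟩, ?_⟩, fun y hy hyc => ?_⟩
            · rw [hP 0 (by omega) v hvA]
              omega
            · rw [Finset.mem_inter] at hy
              rw [hP 0 (by omega) y hy.1] at hyc
              rw [mem_columns]
              omega
          · refine ⟨P (k - t + x + 1), ⟨⟨_, by omega, rfl⟩, ?_⟩, fun y hy hyc => ?_⟩
            · rw [hP _ (by omega) v hvA]
              omega
            · rw [Finset.mem_inter, mem_columns] at hy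
              rw [hP _ (by omega) y hy.1] at hyc
              rw [mem_columns]
              omega
        · refine ⟨P i, ⟨⟨i, by omega, rfl⟩, ?_⟩, fun y hy hyc => ?_⟩
          · rw [hP i (by omega) v hvA]
            omega
          · rw [Finset.mem_inter, mem_columns] at hy
            rw [hP i (by omega) y hy.1] at hyc
            rw [mem_columns]
            omega

end Columns

end CyclePaths

namespace CyclePaths

open SimplicialHomology

/-! ### From paths in the cycle to cyclic segments of columns -/

section Cycle

variable {n m l i : ℕ}

lemma mem_path (hmn : m ≤ n) (hi : i * l < n) {v : Fin n} :
    v ∈ path n m l i ↔ (i * l ≤ v ∧ v < i * l + m) ∨ v + n < i * l + m := by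
  have hv := v.isLt
  simp only [path, Finset.mem_filter, Finset.mem_univ, true_and]
  constructor
  · rintro ⟨j, hj, hvj⟩
    rcases lt_or_ge (i * l + j) n with h | h
    · rw [Nat.mod_eq_of_lt h] at hvj
      omega
    · rw [Nat.mod_eq_sub_mod h, Nat.mod_eq_of_lt (by omega)] at hvj
      omega
  · rintro (h | h)
    · exact ⟨v - i * l, by omega, by rw [Nat.add_sub_cancel' h.1, Nat.mod_eq_of_lt hv]⟩
    · refine ⟨v + n - i * l, by omega, ?_⟩
      rw [Nat.add_sub_cancel' (by omega), Nat.add_mod_right, Nat.mod_eq_of_lt hv]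

lemma card_path (hn : 0 < n) (hmn : m ≤ n) : (path n m l i).card = m := by
  have himage : path n m l i =
      (Finset.range m).image fun j => (⟨(i * l + j) % n, Nat.mod_lt _ hn⟩ : Fin n) := by
    ext v
    simp only [path, Finset.mem_filter, Finset.mem_univ, true_and, Finset.mem_image,
      Finset.mem_range, Fin.ext_iff]
    exact exists_congr fun j => and_congr_right fun _ => eq_comm
  rw [himage, Finset.card_image_of_injOn, Finset.card_range]
  intro a ha b hb hab
  rw [Finset.mem_coe, Finset.mem_range] at ha hb
  have h : a ≡ b [MOD n] := Nat.ModEq.add_left_cancel' (i * l) (Fin.ext_iff.1 hab)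
  exact h.eq_of_lt_of_lt (by omega) (by omega)

/-- The facets of the path complex are the paths, so its complement complex consists of the sets
avoiding some path. -/
lemma complementComplex_pathComplex (hn : 0 < n) (hmn : m ≤ n) (hln : l ∣ n) :
    complementComplex (pathComplex n m l) =
      avoiding Finset.univ {E | ∃ i < n / l, E = path n m l i} := by
  have hgcd : Nat.gcd l n = l := Nat.gcd_eq_left hln
  have hmem : ∀ F, F ∈ pathComplex n m l ↔ ∃ i < n / l, F ⊆ path n m l i := by
    intro F
    rw [pathComplex, mem_lowerClosure, hgcd]
    constructor
    · rintro ⟨_, ⟨i, hi, rfl⟩, hF⟩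
      exact ⟨i, hi, hF⟩
    · rintro ⟨i, hi, hF⟩
      exact ⟨_, ⟨i, hi, rfl⟩, hF⟩
  ext S
  rw [complementComplex, SetLike.mem_coe, mem_lowerClosure]
  constructor
  · rintro ⟨_, ⟨F, hF, rfl⟩, hS⟩
    obtain ⟨i, hi, hFi⟩ := (hmem F).1 hF.1
    have hFi' : path n m l i ⊆ F := hF.2 ((hmem _).2 ⟨i, hi, subset_rfl⟩) hFi
    exact ⟨Finset.subset_univ S, _, ⟨i, hi, rfl⟩,
      Finset.disjoint_of_subset_right hFi' (Finset.subset_compl_iff_disjoint_right.1 hS)⟩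
  · rintro ⟨-, _, ⟨i, hi, rfl⟩, hS⟩
    refine ⟨_, ⟨path n m l i, ⟨(hmem _).2 ⟨i, hi, subset_rfl⟩, fun G hG hle => ?_⟩, rfl⟩,
      Finset.subset_compl_iff_disjoint_right.2 hS⟩
    obtain ⟨j, -, hGj⟩ := (hmem G).1 hG
    -- All paths have `m` vertices, so none properly contains another and each is a facet.
    have hij : path n m l i = path n m l j :=
      Finset.eq_of_subset_of_card_le (Finset.Subset.trans hle hGj)
        (by rw [card_path hn hmn, card_path hn hmn])
    exact hij ▸ hGj

/-- The last vertices of the blocks of length `l`. -/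
def blockEnds (n l : ℕ) : Finset (Fin n) :=
  Finset.univ.filter fun v => (v : ℕ) % l = l - 1

variable {s t k : ℕ}

/-- A block end `v` satisfies `v + 1 = (v / l + 1) * l`, and the surplus `s < l` of a path never
reaches the end of one more block. -/
lemma mem_path_iff_of_mem_blockEnds (hl : 0 < l) (hs : s < l) (hmn : t * l + s ≤ k * l)
    (hi : i < k) {v : Fin (k * l)} (hv : v ∈ blockEnds (k * l) l) :
    v ∈ path (k * l) (t * l + s) l i ↔
      (i ≤ (v : ℕ) / l ∧ (v : ℕ) / l < i + t) ∨ (v : ℕ) / l + k < i + t := by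
  have hv' : (v : ℕ) % l = l - 1 := by simpa [blockEnds] using hv
  have hdiv := Nat.div_add_mod (v : ℕ) l
  rw [hv'] at hdiv
  have hval : (v : ℕ) + 1 = ((v : ℕ) / l + 1) * l := by
    rw [Nat.succ_mul, Nat.mul_comm ((v : ℕ) / l) l]
    omega
  have hlt : ∀ a b : ℕ, a * l + l ≤ b * l + s ↔ a < b := by
    intro a b
    constructor
    · intro h
      exact Nat.lt_of_mul_lt_mul_right (a := l) (by omega)
    · intro h
      have := Nat.mul_le_mul_right l (Nat.succ_le_of_lt h)
      rw [Nat.succ_mul] at this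
      omega
  rw [mem_path hmn (Nat.mul_lt_mul_of_pos_right hi hl), ← Nat.le_div_iff_mul_le hl,
    ← hlt ((v : ℕ) / l) (i + t), ← hlt ((v : ℕ) / l + k) (i + t), add_mul, add_mul]
  rw [Nat.succ_mul] at hval
  omega

lemma injOn_blockEnds : Set.InjOn (fun v : Fin n => (v : ℕ) / l) (blockEnds n l) := by
  intro v hv w hw h
  simp only [blockEnds, Finset.coe_filter, Finset.mem_univ, true_and, Set.mem_ofPred_eq] at hv hw h
  rw [Fin.ext_iff, ← Nat.div_add_mod (v : ℕ) l, ← Nat.div_add_mod (w : ℕ) l, h, hv, hw]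

lemma exists_mem_blockEnds (hl : 0 < l) {j : ℕ} (hj : j < k) :
    ∃ v ∈ blockEnds (k * l) l, (v : ℕ) / l = j := by
  have h := Nat.mul_le_mul_right l (Nat.succ_le_of_lt hj)
  rw [Nat.succ_mul] at h
  refine ⟨⟨j * l + (l - 1), by omega⟩, ?_, ?_⟩
  · simp only [blockEnds, Finset.mem_filter, Finset.mem_univ, true_and]
    rw [Nat.mul_add_mod', Nat.mod_eq_of_lt (by omega)]
  · change (j * l + (l - 1)) / l = j
    rw [Nat.mul_comm, Nat.mul_add_div hl, Nat.div_eq_of_lt (by omega), add_zero]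

variable {K : Type*} [Field K] {e : ℤ} {r : ℕ}

/-- Only the last vertex of each block matters for the homology: it dominates its block. -/
lemma isConcentrated_of_blockEnds (hl : 0 < l) (hmn : m ≤ k * l)
    (h : IsConcentrated K
      (avoiding (blockEnds (k * l) l) {E | ∃ i < k, E = path (k * l) m l i}) e r) :
    IsConcentrated K (avoiding Finset.univ {E | ∃ i < k, E = path (k * l) m l i}) e r := by
  refine isConcentrated_avoiding_of_dominated (Finset.subset_univ _) (fun v _ _ => ?_) h
  have hj : (v : ℕ) / l < k := Nat.div_lt_of_lt_mul (v.isLt.trans_eq (mul_comm k l))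
  obtain ⟨w, hw, hwj⟩ := exists_mem_blockEnds hl hj
  refine ⟨w, hw, ?_⟩
  have hvw : (v : ℕ) ≤ w := by
    have hw' : (w : ℕ) % l = l - 1 := by simpa [blockEnds] using hw
    have h1 := Nat.div_add_mod (v : ℕ) l
    have h2 := Nat.div_add_mod (w : ℕ) l
    have h3 := Nat.mod_lt (v : ℕ) hl
    rw [hwj] at h2
    omega
  rintro _ ⟨i, hi, rfl⟩
  have hil := Nat.mul_lt_mul_of_pos_right hi hl
  rw [mem_path hmn hil, mem_path hmn hil, ← Nat.le_div_iff_mul_le hl (y := (v : ℕ)),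
    ← Nat.le_div_iff_mul_le hl (y := (w : ℕ)), hwj]
  omega

lemma isConcentrated_avoiding_paths (hl : 0 < l) (hs : s < l) (ht : 0 < t) (htk : t < k)
    (hmn : t * l + s ≤ k * l) {R : ℕ → ℕ}
    (hR : ∀ x < t, ∃ r, R (x + 1) = R x + r ∧ SegmentDegree t (k - t + x) (x + 1) (e - 1) r)
    (hR0 : R 0 = 0) :
    IsConcentrated K
      (avoiding Finset.univ {E | ∃ i < k, E = path (k * l) (t * l + s) l i}) e (R t) := by
  refine isConcentrated_of_blockEnds hl hmn ?_
  have key := isConcentrated_cyclic (K := K) (A := blockEnds (k * l) l)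
    (col := fun v : Fin (k * l) => (v : ℕ) / l) injOn_blockEnds
    (fun j hj => exists_mem_blockEnds hl hj) ht htk
    (fun i hi v hv => mem_path_iff_of_mem_blockEnds hl hs hmn hi hv) hR hR0 le_rfl
  rwa [Finset.inter_eq_left.2] at key
  intro v _
  rw [mem_columns, Nat.sub_add_cancel htk.le]
  exact ⟨Nat.zero_le _, Nat.div_lt_of_lt_mul (v.isLt.trans_eq (mul_comm k l))⟩

/-- The homology of the complement complex when `t + 1` divides `k`. -/
theorem isConcentrated_avoiding_paths_of_dvd {p : ℕ} (hl : 0 < l) (hs : s < l) (ht : 0 < t)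
    (hmn : t * l + s ≤ k * l) (hkp : k = p * (t + 1)) :
    IsConcentrated K
      (avoiding Finset.univ {E | ∃ i < k, E = path (k * l) (t * l + s) l i}) (2 * p - 2) t := by
  have htk : t ≤ k := Nat.le_of_mul_le_mul_right ((Nat.le_add_right _ _).trans hmn) hl
  obtain ⟨p, rfl⟩ := Nat.exists_eq_succ_of_ne_zero (n := p) (by rintro rfl; omega)
  rw [Nat.succ_mul] at hkp
  -- Each restored column adds one class, as `k - t + x = p * (t + 1) + (x + 1)` for the lowered
  -- `p`.
  refine isConcentrated_avoiding_paths hl hs ht (by omega) hmn (R := id) (fun x hx => ?_) rfl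
  exact ⟨1, rfl, Or.inl ⟨p, by omega, by push_cast; ring, rfl⟩⟩

/-- The homology of the complement complex when `t + 1` does not divide `k`. -/
theorem isConcentrated_avoiding_paths_of_not_dvd {p d : ℕ} (hl : 0 < l) (hs : s < l) (ht : 0 < t)
    (hmn : t * l + s ≤ k * l) (hkp : k = p * (t + 1) + d) (hd : d ≤ t) (hd0 : d ≠ 0) :
    IsConcentrated K
      (avoiding Finset.univ {E | ∃ i < k, E = path (k * l) (t * l + s) l i}) (2 * p - 1) 1 := by
  have htk : t ≤ k := Nat.le_of_mul_le_mul_right ((Nat.le_add_right _ _).trans hmn) hl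
  rcases Nat.eq_zero_or_pos p with rfl | hp
  -- Here `k = d ≤ t ≤ k`, so every path is the whole vertex set and the complex is `{∅}`.
  · obtain rfl : t = k := by omega
    refine isConcentrated_singleton_empty fun S => ⟨?_, ?_⟩
    · rintro ⟨-, _, ⟨i, hi, rfl⟩, hS⟩
      refine Finset.eq_empty_of_forall_notMem fun v hv => Finset.disjoint_left.1 hS hv ?_
      have := v.isLt
      rw [mem_path hmn (Nat.mul_lt_mul_of_pos_right hi hl)]
      omega
    · rintro rfl
      exact ⟨Finset.empty_subset _, _, ⟨0, ht, rfl⟩, Finset.disjoint_empty_left _⟩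
  · obtain ⟨p, rfl⟩ := Nat.exists_eq_succ_of_ne_zero hp.ne'
    rw [Nat.succ_mul] at hkp
    -- The only class appears on restoring the column with `x = t - d`, where `k - t + x` is a
    -- multiple of `t + 1`; hence `R` jumps at `t + 1 - d`.
    have key := isConcentrated_avoiding_paths (K := K) (e := 2 * ((p + 1 : ℕ) : ℤ) - 1) hl hs ht
      (by omega) hmn (R := fun x => if t + 1 - d ≤ x then 1 else 0) (fun x hx => ?_)
      (if_neg (by omega))
    · simpa only [if_pos (show t + 1 - d ≤ t by omega)] using key
    · by_cases hxd : x + d = t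
      · refine ⟨1, ?_, Or.inr (Or.inl ⟨p, by omega, by push_cast; ring, rfl⟩)⟩
        rw [if_pos (by omega), if_neg (by omega)]
      · refine ⟨0, ?_, Or.inr (Or.inr ⟨fun q => ?_, rfl⟩)⟩
        · by_cases h : t + 1 - d ≤ x
          · rw [if_pos (by omega), if_pos h]
          · rw [if_neg (by omega), if_neg h]
        -- Distinct multiples of `t + 1` differ by at least `t + 1`; with this the remaining
        -- exclusions are linear.
        · have hq : q * (t + 1) + (t + 1) ≤ p * (t + 1) ∨ q * (t + 1) = p * (t + 1) ∨
              p * (t + 1) + (t + 1) ≤ q * (t + 1) := by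
            rcases lt_trichotomy q p with h | rfl | h
            · exact Or.inl ((Nat.succ_mul q (t + 1)).symm.trans_le (Nat.mul_le_mul_right _ h))
            · exact Or.inr (Or.inl rfl)
            · exact Or.inr (Or.inr
                ((Nat.succ_mul p (t + 1)).symm.trans_le (Nat.mul_le_mul_right _ h)))
          omega

end Cycle

end CyclePaths

open SimplicialHomology CyclePaths in
theorem theorem4p7 (K : Type*) [Field K] (l m n s t k p d : ℕ)
    (hl : 0 < l) (hm : 2 ≤ m) (hmn : m ≤ n) (hln : l ∣ n) (hlmin : l ≤ min (m - 1) (n / 2))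
    (hms : m ≡ s [MOD l]) (hs : s < l) (ht : t = (m - s) / l) (ht2 : 2 ≤ t) (hk : k = n / l)
    (hkp : k = p * (t + 1) + d) (hd : d ≤ t) (i : ℤ) :
    (d = 0 ∧ i = 2 * (p : ℤ) - 2 ∧ 0 < p →
      Nonempty (ReducedHomology K (complementComplex (pathComplex n m l)) i ≃ₗ[K] (Fin t → K))) ∧
    (d ≠ 0 ∧ i = 2 * (p : ℤ) - 1 →
      Nonempty (ReducedHomology K (complementComplex (pathComplex n m l)) i ≃ₗ[K] K)) ∧
    (¬ (d = 0 ∧ i = 2 * (p : ℤ) - 2 ∧ 0 < p) → ¬ (d ≠ 0 ∧ i = 2 * (p : ℤ) - 1) →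
      Subsingleton (ReducedHomology K (complementComplex (pathComplex n m l)) i)) := by
  have hn : 0 < n := by omega
  have hnk : n = k * l := by rw [hk, Nat.div_mul_cancel hln]
  have hsm : s ≤ m := by omega
  have hmt : m = t * l + s := by
    rw [ht, Nat.div_mul_cancel ((Nat.modEq_iff_dvd' hsm).1 hms.symm), Nat.sub_add_cancel hsm]
  rw [complementComplex_pathComplex hn hmn hln, ← hk]
  subst hnk hmt
  by_cases hd0 : d = 0
  · have key := isConcentrated_avoiding_paths_of_dvd (K := K) (p := p) hl hs (by omega) hmn
      (by rw [hkp, hd0, add_zero])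
    have hp : 0 < p := by
      rcases Nat.eq_zero_or_pos p with rfl | hp
      · rw [hd0, zero_mul] at hkp
        rw [hkp] at hn
        omega
      · exact hp
    refine ⟨?_, fun h => absurd hd0 h.1, fun h _ => key.subsingleton_of_ne fun hi => ?_⟩
    · rintro ⟨-, rfl, -⟩
      exact key.nonempty_linearEquiv
    · exact h ⟨hd0, hi, hp⟩
  · have key := isConcentrated_avoiding_paths_of_not_dvd (K := K) hl hs (by omega) hmn hkp hd hd0
    refine ⟨fun h => absurd h.1 hd0, ?_, fun _ h => key.subsingleton_of_ne fun hi => ?_⟩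
    · rintro ⟨-, rfl⟩
      exact key.nonempty_linearEquiv.map fun f => f.trans (LinearEquiv.funUnique (Fin 1) K K)
    · exact h ⟨hd0, hi⟩
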